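/- **Definitions.** Let $X$ be a finite set. Write $1=\{(x,x):x\in X\}$ and, for $r\subseteq X\times X$, $r^*=\{(y,z):(z,y)\in r\}$. An *association scheme* on $X$ is a partition $S$ of $X\times X$ with $1\in S$ and $s^*\in S$ for all $s\in S$, such that for all $p,q,r\in S$ there is an integer $a_{pqr}$ with $|\{w\in X:(y,w)\in p,\ (w,z)\in q\}|=a_{pqr}$ for all $(y,z)\in r$. For $P,Q\subseteq S$, the complex product $PQ$ is the set of all $s\in S$ with $a_{pqs}\neq 0$ for some $p\in P$, $q\in Q$ (a singleton $\{p\}$ is written $p$). A non-empty $R\subseteq S$ is *closed* if $p^*q\subseteq R$ for all $p,q\in R$. The valency of $s\in S$ is $n_s=a_{ss^*1}$, and the valency of a closed subset $T$ is $n_T=\sum_{t\in T}n_t$. For closed subsets $T\subseteq U$, the index of $T$ in $U$ is the integer $n_U/n_T$, and $T$ is *strongly normal* in $U$ if $u^*Tu\subseteq T$ for all $u\in U$. The scheme $S$ is *solvable* if it has closed subsets $T_0,\ldots,T_n$ with $T_0=\{1\}$ and $T_n=S$ such that, for each $i\in\{1,\ldots,n\}$, $T_{i-1}\subseteq T_i$,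 and $T_{i-1}$ is strongly normal and of prime index in $T_i$. Let $\pi$ be a set of primes and $\pi'$ the set of primes not in $\pi$. A positive integer is a *$\pi$-number* if all its prime divisors lie in $\pi$. A closed subset of $S$ (in particular $S$ itself) is *$\pi$-valenced* if the valency of each of its elements is a $\pi$-number. A *closed $\pi$-subset* of $S$ is a $\pi$-valenced closed subset $T$ for which $n_T$ is a $\pi$-number; it is a *Hall $\pi$-subset* of $S$ if moreover its index in $S$ is a $\pi'$-number. Closed subsets $T,U$ of $S$ are *conjugate in $S$* if $s^*Ts=U$ for some $s\in S$. **Theorem.** Let $\pi$ be a set of primes, and let $S$ be a solvable, $\pi$-valenced association scheme on a finite set $X$. Then: (i) $S$ has at least one Hall $\pi$-subset; (ii) any two Hall $\pi$-subsets of $S$ are conjugate in $S$; (iii) every closed $\pi$-subset of $S$ is contained in a Hall $\pi$-subset of $S$. -/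

import Mathlib

universe u

/-- An association scheme on the finite set `X`: a partition of `X × X` (into non-empty blocks,
which forces `X` to be non-empty) that contains the diagonal, is closed under transposition, and is
regular: for all blocks `p`, `q`, `r` the number of `w` with `(y, w) ∈ p` and `(w, z) ∈ q` is the
same for all `(y, z) ∈ r`. -/
structure AssociationScheme (X : Type u) [Finite X] where
  /-- the set of blocks -/
  rels : Set (Set (X × X))
  isPartition : Setoid.IsPartition rels
  one_mem : {a : X × X | a.1 = a.2} ∈ rels
  star_mem : ∀ s ∈ rels, {a : X × X | (a.2, a.1) ∈ s} ∈ rels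
  regular : ∀ p ∈ rels, ∀ q ∈ rels, ∀ r ∈ rels, ∃ k : ℕ, ∀ y z : X, (y, z) ∈ r →
    {w : X | (y, w) ∈ p ∧ (w, z) ∈ q}.ncard = k

namespace AssociationScheme

variable {X : Type u} [Finite X] (S : AssociationScheme X)

/-- The elements of the scheme `S`, as a type. -/
def Elem : Type u := {s : Set (X × X) // s ∈ S.rels}

instance : Finite S.Elem := by
  unfold Elem
  infer_instance

/-- The element `1` of `S`: the diagonal. -/
def one : S.Elem := ⟨{a : X × X | a.1 = a.2}, S.one_mem⟩

/-- The transposed relation `s*`. -/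
def star (s : S.Elem) : S.Elem := ⟨{a : X × X | (a.2, a.1) ∈ s.1}, S.star_mem s.1 s.2⟩

/-- The structure constant `a_{pqr}`; it is unique since `r` is non-empty. -/
noncomputable def structConst (p q r : S.Elem) : ℕ :=
  Classical.choose (S.regular p.1 p.2 q.1 q.2 r.1 r.2)

theorem structConst_spec (p q r : S.Elem) {y z : X} (h : (y, z) ∈ r.1) :
    {w : X | (y, w) ∈ p.1 ∧ (w, z) ∈ q.1}.ncard = S.structConst p q r :=
  Classical.choose_spec (S.regular p.1 p.2 q.1 q.2 r.1 r.2) y z h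

/-- The complex product `PQ` of two subsets of `S`. -/
def complexMul (P Q : Set S.Elem) : Set S.Elem :=
  {s | ∃ p ∈ P, ∃ q ∈ Q, S.structConst p q s ≠ 0}

/-- Closed subsets of `S`. -/
def IsClosedSubset (R : Set S.Elem) : Prop :=
  R.Nonempty ∧ ∀ p ∈ R, ∀ q ∈ R, S.complexMul {S.star p} {q} ⊆ R

/-- The valency `n_s = a_{s s* 1}` of an element of `S`. -/
noncomputable def valency (s : S.Elem) : ℕ := S.structConst s (S.star s) S.one

/-- The valency `n_T` of a subset: the (finite) sum of the valencies of its elements. -/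
noncomputable def setValency (T : Set S.Elem) : ℕ := ∑ᶠ t ∈ T, S.valency t

/-- The set `s* T s`. -/
def conj (s : S.Elem) (T : Set S.Elem) : Set S.Elem :=
  S.complexMul (S.complexMul {S.star s} T) {s}

/-- Two (closed) subsets `T` and `U` are conjugate in `S` if `s* T s = U` for some `s` in `S`. -/
def AreConjugate (T U : Set S.Elem) : Prop := ∃ s : S.Elem, S.conj s T = U

/-- The index of `T` in `U`. It is used only for closed subsets `T ⊆ U`, where `n_T` is positive
and divides `n_U`, so the division is exact. -/
noncomputable def index (T U : Set S.Elem) : ℕ := S.setValency U / S.setValency T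

/-- `T` is strongly normal in `U` (for closed subsets `T` and `U`). -/
def IsStronglyNormalIn (T U : Set S.Elem) : Prop :=
  T ⊆ U ∧ ∀ u ∈ U, S.conj u T ⊆ T

/-- Solvable association schemes. -/
def IsSolvable : Prop :=
  ∃ (n : ℕ) (T : ℕ → Set S.Elem),
    (∀ i ≤ n, S.IsClosedSubset (T i)) ∧ T 0 = {S.one} ∧ T n = Set.univ ∧
    ∀ i < n, S.IsStronglyNormalIn (T i) (T (i + 1)) ∧ (S.index (T i) (T (i + 1))).Prime

/-- A `π`-number: a positive integer all of whose prime divisors belong to `π`. -/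
def IsPiNumber (π : Set ℕ) (n : ℕ) : Prop := 0 < n ∧ ∀ p : ℕ, p.Prime → p ∣ n → p ∈ π

/-- The set `π'` of all primes that do not belong to `π`. -/
def primeCompl (π : Set ℕ) : Set ℕ := {p | p.Prime ∧ p ∉ π}

/-- All elements of the (closed) subset `T` have valency a `π`-number. -/
def IsPiValencedSubset (π : Set ℕ) (T : Set S.Elem) : Prop :=
  ∀ t ∈ T, IsPiNumber π (S.valency t)

/-- The scheme `S` is `π`-valenced. -/
def IsPiValenced (π : Set ℕ) : Prop := S.IsPiValencedSubset π Set.univ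

/-- Closed `π`-subsets of `S`. -/
def IsClosedPiSubset (π : Set ℕ) (T : Set S.Elem) : Prop :=
  S.IsClosedSubset T ∧ S.IsPiValencedSubset π T ∧ IsPiNumber π (S.setValency T)

/-- Hall `π`-subsets of `S`. -/
def IsHallPiSubset (π : Set ℕ) (T : Set S.Elem) : Prop :=
  S.IsClosedPiSubset π T ∧ IsPiNumber (primeCompl π) (S.index T Set.univ)

end AssociationScheme

/-!
The idea is to find a closed subset `P` that is strongly normal in `S` and whose valency is a
`π`-number. Then `S // P` is a finite solvable group, closed `π`-subsets correspond to
`π`-subgroups of it under image and preimage, and the theorem follows from P. Hall's theorem on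
solvable groups.

To find `P`, climb the series `T 0 ⊆ ⋯ ⊆ T n` that exhibits the solvability of `S`, choosing at
each stage a closed `P`, strongly normal in `T i`, whose valency is a `π`-number and as large as
possible. Strong normality of `P` passes from `T i` to `T (i + 1)`: for `u` in `T (i + 1)` and
`D = PuP`, the set `D* D = P (u* P u) P` is again closed and strongly normal in `T i`, and its
valency `n_D` is a `π`-number because it divides `n_P n_u n_P`. By maximality `D* D = P`, so
`u* P u ⊆ P`.

Hall's theorem itself is proved by induction through an abelian normal `p`-subgroup `N`: if `p` is
in `π`, pull back along `G → G / N`; otherwise use the existence and conjugacy of complements of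
`N` (Schur–Zassenhaus).
-/

open scoped Pointwise
open AssociationScheme (IsPiNumber primeCompl)

section PiNumber

variable {π : Set ℕ} {m n : ℕ}

theorem isPiNumber_one (π : Set ℕ) : IsPiNumber π 1 :=
  ⟨one_pos, fun _ hp h => absurd (Nat.dvd_one.1 h) hp.ne_one⟩

theorem isPiNumber_prime_pow {p : ℕ} (hp : p.Prime) (h : p ∈ π) (k : ℕ) : IsPiNumber π (p ^ k) :=
  ⟨pow_pos hp.pos k, fun _ hq hqp =>
    (Nat.prime_dvd_prime_iff_eq hq hp).1 (hq.dvd_of_dvd_pow hqp) ▸ h⟩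

namespace AssociationScheme.IsPiNumber

theorem of_dvd (hn : IsPiNumber π n) (h : m ∣ n) : IsPiNumber π m :=
  ⟨Nat.pos_of_dvd_of_pos h hn.1, fun p hp hpm => hn.2 p hp (hpm.trans h)⟩

theorem mul (hm : IsPiNumber π m) (hn : IsPiNumber π n) : IsPiNumber π (m * n) :=
  ⟨Nat.mul_pos hm.1 hn.1, fun p hp h => (hp.dvd_mul.1 h).elim (hm.2 p hp) (hn.2 p hp)⟩

theorem coprime (hm : IsPiNumber π m) (hn : IsPiNumber (primeCompl π) n) : m.Coprime n :=
  Nat.coprime_of_dvd fun p hp hpm hpn => (hn.2 p hp hpn).2 (hm.2 p hp hpm)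

end AssociationScheme.IsPiNumber

end PiNumber

section AbelianNormalComplements

open Subgroup

variable {G : Type*} [Group G]

open MulOpposite in
theorem exists_stabilizer_quotientDiff_eq [Finite G] {N K : Subgroup G} [N.Normal]
    [IsMulCommutative N] (hN : (Nat.card N).Coprime N.index) (hK : IsComplement' N K) :
    ∃ α : N.QuotientDiff, MulAction.stabilizer G α = K := by
  let α : N.QuotientDiff := Quotient.mk'' ⟨(K : Set G), hK.symm⟩
  have hle : K ≤ MulAction.stabilizer G α := fun k hk => by
    refine congrArg Quotient.mk'' (Subtype.ext ?_)
    change (op k⁻¹ : Gᵐᵒᵖ) • (K : Set G) = K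
    ext x
    simp [Set.mem_smul_set_iff_inv_smul_mem, K.mul_mem_cancel_right hk]
  have hcard : N.IsComplement' (MulAction.stabilizer G α) := isComplement'_stabilizer_of_coprime hN
  exact ⟨α, (eq_of_le_of_card_ge hle
    (by rw [← hcard.symm.index_eq_card, hK.symm.index_eq_card])).symm⟩

-- `N` acts transitively on `N.QuotientDiff`, and every complement of `N` is a point stabilizer.
theorem exists_eq_conj_smul_of_isComplement' [Finite G] {N H K : Subgroup G} [N.Normal]
    [IsMulCommutative N] (hN : (Nat.card N).Coprime N.index) (hH : IsComplement' N H)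
    (hK : IsComplement' N K) : ∃ g : G, K = MulAut.conj g • H := by
  obtain ⟨α, rfl⟩ := exists_stabilizer_quotientDiff_eq hN hH
  obtain ⟨β, rfl⟩ := exists_stabilizer_quotientDiff_eq hN hK
  obtain ⟨n, rfl⟩ := Subgroup.exists_smul_eq hN α β
  exact ⟨n, MulAction.stabilizer_smul_eq_stabilizer_map_conj (n : G) α⟩

theorem isComplement'_subgroupOf_of_le_sup {N L M : Subgroup G} [N.Normal] (hNL : N ≤ L)
    (hL : L ≤ N ⊔ M) (hM : Disjoint N M) :
    IsComplement' (N.subgroupOf L) (M.subgroupOf L) := by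
  refine isComplement'_of_disjoint_and_mul_eq_univ ?_ (Set.eq_univ_of_forall ?_)
  · rw [disjoint_iff, subgroupOf, subgroupOf, ← comap_inf, hM.eq_bot]
    exact bot_subgroupOf L
  · rintro ⟨x, hx⟩
    obtain ⟨n, hn, m, hm, rfl⟩ : x ∈ (N : Set G) * M := normal_mul N M ▸ hL hx
    exact ⟨⟨n, hNL hn⟩, hn, ⟨m, (L.mul_mem_cancel_left (hNL hn)).1 hx⟩, hm, rfl⟩

theorem exists_le_conj_smul_of_coprime [Finite G] {N H K : Subgroup G} [N.Normal]
    [IsMulCommutative N] (hH : (Nat.card N).Coprime (Nat.card H))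
    (hK : (Nat.card N).Coprime (Nat.card K)) (hle : K ≤ N ⊔ H) :
    ∃ g : G, K ≤ MulAut.conj g • H := by
  set L := N ⊔ K
  have hNL : N ≤ L := le_sup_left
  have hKL : K ≤ L := le_sup_right
  have hHc : IsComplement' (N.subgroupOf L) (H.subgroupOf L) :=
    isComplement'_subgroupOf_of_le_sup hNL (sup_le le_sup_left hle) (disjoint_of_coprime_natCard hH)
  have hKc : IsComplement' (N.subgroupOf L) (K.subgroupOf L) :=
    isComplement'_subgroupOf_of_le_sup hNL le_rfl (disjoint_of_coprime_natCard hK)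
  have hcop : (Nat.card (N.subgroupOf L)).Coprime (N.subgroupOf L).index := by
    rwa [hKc.symm.index_eq_card, Nat.card_congr (subgroupOfEquivOfLe hNL).toEquiv,
      Nat.card_congr (subgroupOfEquivOfLe hKL).toEquiv]
  obtain ⟨g, hg⟩ := exists_eq_conj_smul_of_isComplement' hcop hHc hKc
  refine ⟨g, fun k hk => mem_pointwise_smul_iff_inv_smul_mem.2 ?_⟩
  have hkg : (⟨k, hKL hk⟩ : L) ∈ MulAut.conj g • H.subgroupOf L := hg ▸ mem_subgroupOf.2 hk
  exact mem_subgroupOf.1 (mem_pointwise_smul_iff_inv_smul_mem.1 hkg)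

end AbelianNormalComplements

section SolvableGroups

theorem exists_normal_isMulCommutative_ne_bot (G : Type*) [Group G] [Finite G]
    [Group.IsSolvable G] [Nontrivial G] :
    ∃ A : Subgroup G, A.Normal ∧ IsMulCommutative A ∧ A ≠ ⊥ := by
  obtain ⟨A, ⟨hA, hA'⟩, hmin⟩ := (Set.toFinite {A : Subgroup G | A.Normal ∧ A ≠ ⊥}).exists_minimal
    ⟨⊤, inferInstance, top_ne_bot⟩
  have hlt : ⁅A, A⁆ < A := Group.IsSolvable.commutator_lt_of_ne_bot hA'
  have hbot : ⁅A, A⁆ = ⊥ := by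
    by_contra h
    exact hlt.not_ge (hmin ⟨Subgroup.commutator_normal A A, h⟩ hlt.le)
  exact ⟨A, hA, Subgroup.le_centralizer_iff_isMulCommutative.1
    (Subgroup.commutator_eq_bot_iff_le_centralizer.1 hbot), hA'⟩

theorem exists_normal_isMulCommutative_isPGroup_ne_bot (G : Type*) [Group G] [Finite G]
    [Group.IsSolvable G] [Nontrivial G] :
    ∃ (p : ℕ) (N : Subgroup G),
      p.Prime ∧ N.Normal ∧ IsMulCommutative N ∧ IsPGroup p N ∧ N ≠ ⊥ := by
  obtain ⟨A, hA, hAc, hA'⟩ := exists_normal_isMulCommutative_ne_bot G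
  obtain ⟨p, hp, hpA⟩ := Nat.exists_prime_and_dvd (mt A.eq_bot_of_card_eq hA')
  have : Fact p.Prime := ⟨hp⟩
  let P : Sylow p A := default
  have : (P : Subgroup A).Characteristic := P.characteristic_of_normal inferInstance
  refine ⟨p, (P : Subgroup A).map A.subtype, hp, ConjAct.normal_of_characteristic_of_normal,
    inferInstance, P.isPGroup'.map _, fun h => P.ne_bot_of_dvd_card hpA ?_⟩
  exact ((P : Subgroup A).map_eq_bot_iff_of_injective A.subtype_injective).1 h

theorem finite_solvable_group_induction {motive : ∀ (G : Type u) [Group G], Prop}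
    (subsingleton : ∀ (G : Type u) [Group G] [Subsingleton G], motive G)
    (of_quotient : ∀ (G : Type u) [Group G] [Finite G] (p : ℕ) (N : Subgroup G) [N.Normal]
      [IsMulCommutative N], p.Prime → IsPGroup p N → motive (G ⧸ N) → motive G)
    (G : Type u) [Group G] [Finite G] [Group.IsSolvable G] : motive G := by
  induction hn : Nat.card G using Nat.strong_induction_on generalizing G with
  | _ n ih =>
  subst hn
  rcases subsingleton_or_nontrivial G with hG | hG
  · exact subsingleton G
  · obtain ⟨p, N, hp, hN, hNc, hNp, hN'⟩ := exists_normal_isMulCommutative_isPGroup_ne_bot G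
    have hlt : Nat.card (G ⧸ N) < Nat.card G := by
      rw [N.card_eq_card_quotient_mul_card_subgroup]
      exact lt_mul_of_one_lt_right Nat.card_pos (N.one_lt_card_iff_ne_bot.2 hN')
    exact of_quotient G p N hp hNp (ih _ hlt (G ⧸ N) rfl)

theorem isSolvable_of_relIndex_dvd_prime {G : Type*} [Group G] {H K : Subgroup G} {p : ℕ}
    (hHK : H ≤ K) (hnormal : (H.subgroupOf K).Normal) (hH : Group.IsSolvable H) (hp : p.Prime)
    (hdvd : H.relIndex K ∣ p) : Group.IsSolvable K := by
  have : Fact p.Prime := ⟨hp⟩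
  refine (Group.isSolvable_iff_subgroup_quotient (H.subgroupOf K)).2 ⟨?_, ?_⟩
  · exact Group.isSolvable_of_isSolvable_injective
      (f := (Subgroup.subgroupOfEquivOfLe hHK).toMonoidHom)
      (Subgroup.subgroupOfEquivOfLe hHK).injective
  · have : IsCyclic (K ⧸ H.subgroupOf K) := isCyclic_of_card_dvd_prime hdvd
    exact Group.isSolvable_of_comm mul_comm'

end SolvableGroups

/-- Hall `π`-subgroups: the order is a `π`-number and the index is a `π'`-number. -/
def IsHallSubgroup {G : Type*} [Group G] (π : Set ℕ) (H : Subgroup G) : Prop :=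
  IsPiNumber π (Nat.card H) ∧ IsPiNumber (primeCompl π) H.index

namespace IsHallSubgroup

open Subgroup

variable {G : Type*} [Group G] {π : Set ℕ} {H K N : Subgroup G}

theorem conj_smul (hH : IsHallSubgroup π H) (g : G) : IsHallSubgroup π (MulAut.conj g • H) := by
  refine ⟨?_, ?_⟩
  · rw [← Nat.card_congr (equivSMul (MulAut.conj g) H).toEquiv]
    exact hH.1
  · rw [pointwise_smul_def]
    exact (H.index_map_equiv (MulAut.conj g)).symm ▸ hH.2

theorem map {G' : Type*} [Group G'] (hH : IsHallSubgroup π H) {f : G →* G'}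
    (hf : Function.Surjective f) : IsHallSubgroup π (H.map f) :=
  ⟨hH.1.of_dvd (card_map_dvd H f), hH.2.of_dvd (H.index_map_dvd hf)⟩

theorem comap {G' : Type*} [Group G'] {H : Subgroup G'} (hH : IsHallSubgroup π H) {f : G →* G'}
    (hf : Function.Surjective f) (hker : IsPiNumber π (Nat.card f.ker)) :
    IsHallSubgroup π (H.comap f) := by
  refine ⟨?_, (H.index_comap_of_surjective hf).symm ▸ hH.2⟩
  rw [← relIndex_bot_left, ← relIndex_mul_relIndex ⊥ f.ker _ bot_le (ker_le_comap f H),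
    relIndex_bot_left, relIndex_ker, map_comap_eq_self_of_surjective hf]
  exact hker.mul hH.1

theorem map_subtype {M : Subgroup G} {C : Subgroup M} (hC : IsHallSubgroup π C)
    (hM : IsPiNumber (primeCompl π) M.index) : IsHallSubgroup π (C.map M.subtype) := by
  refine ⟨?_, ?_⟩
  · rw [card_map_of_injective M.subtype_injective]
    exact hC.1
  · rw [index_map_subtype]
    exact hC.2.mul hM

theorem eq_of_le (hH : IsHallSubgroup π H) (hle : H ≤ K) (hK : IsPiNumber π (Nat.card K)) :
    H = K := by
  refine hle.antisymm (relIndex_eq_one.1 (Nat.eq_one_of_dvd_coprimes (hK.coprime hH.2) ?_ ?_))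
  · exact relIndex_dvd_card H K
  · exact relIndex_dvd_index_of_le hle

theorem normal_le [N.Normal] (hH : IsHallSubgroup π H) (hN : IsPiNumber π (Nat.card N)) :
    N ≤ H := by
  have hNH : IsPiNumber π (Nat.card (N ⊔ H : Subgroup G)) := by
    rw [← relIndex_bot_left, ← relIndex_mul_relIndex ⊥ N _ bot_le le_sup_left, relIndex_bot_left,
      relIndex_sup_left]
    exact hN.mul (hH.1.of_dvd (relIndex_dvd_card N H))
  exact le_sup_left.trans (hH.eq_of_le le_sup_right hNH).ge

theorem exists_of_normal (N : Subgroup G) [N.Normal]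
    (hN : IsPiNumber (primeCompl π) (Nat.card N)) (hN' : IsPiNumber π N.index) :
    ∃ C : Subgroup G, IsHallSubgroup π C := by
  obtain ⟨C, hC⟩ := exists_right_complement'_of_coprime (hN'.coprime hN).symm
  exact ⟨C, hC.symm.index_eq_card ▸ hN', hC.index_eq_card ▸ hN⟩

end IsHallSubgroup

section HallTheorem

open Subgroup

variable {π : Set ℕ} {G G' : Type*} [Group G] [Group G']

theorem isPiNumber_or_isPiNumber_primeCompl_of_isPGroup [Finite G] {p : ℕ} (hp : p.Prime)
    (hG : IsPGroup p G) (π : Set ℕ) :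
    IsPiNumber π (Nat.card G) ∨ IsPiNumber (primeCompl π) (Nat.card G) := by
  have : Fact p.Prime := ⟨hp⟩
  obtain ⟨k, hk⟩ := IsPGroup.iff_card.1 hG
  rw [hk]
  exact (em (p ∈ π)).imp (isPiNumber_prime_pow hp · k)
    fun h => isPiNumber_prime_pow hp (show p ∈ primeCompl π from ⟨hp, h⟩) k

theorem exists_isHallSubgroup_of_surjective {f : G →* G'} (hf : Function.Surjective f)
    (hker : IsPiNumber π (Nat.card f.ker) ∨ IsPiNumber (primeCompl π) (Nat.card f.ker))
    {H : Subgroup G'} (hH : IsHallSubgroup π H) : ∃ K : Subgroup G, IsHallSubgroup π K := by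
  rcases hker with hker | hker
  · exact ⟨H.comap f, hH.comap hf hker⟩
  · let M := H.comap f
    have hcard : Nat.card (f.ker.subgroupOf M) = Nat.card f.ker :=
      Nat.card_congr (subgroupOfEquivOfLe (ker_le_comap f H)).toEquiv
    have hindex : (f.ker.subgroupOf M).index = Nat.card H := by
      rw [← relIndex, relIndex_ker, map_comap_eq_self_of_surjective hf]
    obtain ⟨C, hC⟩ := IsHallSubgroup.exists_of_normal (π := π) (f.ker.subgroupOf M)
      (hcard ▸ hker) (hindex ▸ hH.1)
    exact ⟨C.map M.subtype, hC.map_subtype ((H.index_comap_of_surjective hf).symm ▸ hH.2)⟩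

theorem exists_isHallSubgroup (π : Set ℕ) (G : Type u) [Group G] [Finite G] [Group.IsSolvable G] :
    ∃ H : Subgroup G, IsHallSubgroup π H := by
  refine finite_solvable_group_induction
    (motive := fun G _ => ∃ H : Subgroup G, IsHallSubgroup π H)
    (fun G _ _ => ⟨⊥, ?_, ?_⟩) (fun G _ _ p N _ _ hp hN ⟨H, hH⟩ => ?_) G
  · simpa only [card_bot] using isPiNumber_one π
  · simpa only [index_bot, Nat.card_unique] using isPiNumber_one (primeCompl π)
  · refine exists_isHallSubgroup_of_surjective (QuotientGroup.mk'_surjective N) ?_ hH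
    rw [QuotientGroup.ker_mk']
    exact isPiNumber_or_isPiNumber_primeCompl_of_isPGroup hp hN π

theorem conj_smul_map (f : G →* G') (g : G) (H : Subgroup G) :
    MulAut.conj (f g) • H.map f = (MulAut.conj g • H).map f := by
  simp only [pointwise_smul_def]
  ext x
  simp

theorem le_ker_sup_conj_smul {f : G →* G'} {g : G} {H K : Subgroup G}
    (h : K.map f ≤ MulAut.conj (f g) • H.map f) : K ≤ f.ker ⊔ MulAut.conj g • H := by
  rwa [conj_smul_map, map_le_iff_le_comap, comap_map_eq, sup_comm] at h

theorem exists_le_conj_smul_of_isHallSubgroup {G : Type u} [Group G] [Finite G]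
    [Group.IsSolvable G] {H K : Subgroup G} (hH : IsHallSubgroup π H)
    (hK : IsPiNumber π (Nat.card K)) : ∃ g : G, K ≤ MulAut.conj g • H := by
  refine finite_solvable_group_induction
    (motive := fun G _ => ∀ H K : Subgroup G, IsHallSubgroup π H → IsPiNumber π (Nat.card K) →
      ∃ g : G, K ≤ MulAut.conj g • H)
    (fun G _ _ H K _ _ => ⟨1, fun x _ => ?_⟩) (fun G _ _ p N _ _ hp hN ih H K hH hK => ?_)
    G H K hH hK
  · exact Subsingleton.elim 1 x ▸ Subgroup.one_mem _
  · obtain ⟨g, hg⟩ := ih _ _ (hH.map (QuotientGroup.mk'_surjective N))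
      (hK.of_dvd (card_map_dvd K _))
    obtain ⟨g, rfl⟩ := QuotientGroup.mk'_surjective N g
    have hle : K ≤ N ⊔ MulAut.conj g • H := QuotientGroup.ker_mk' N ▸ le_ker_sup_conj_smul hg
    rcases isPiNumber_or_isPiNumber_primeCompl_of_isPGroup hp hN π with hN | hN
    · exact ⟨g, sup_eq_right.2 ((hH.conj_smul g).normal_le hN) ▸ hle⟩
    · obtain ⟨g', hg'⟩ := exists_le_conj_smul_of_coprime
        ((hH.conj_smul g).1.coprime hN).symm (hK.coprime hN).symm hle
      exact ⟨g' * g, by rwa [map_mul, mul_smul]⟩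

end HallTheorem

namespace AssociationScheme

variable {X : Type u} [Finite X] {S : AssociationScheme X}

section Relations

variable (S) in
theorem exists_mem (x y : X) : ∃ s : S.Elem, (x, y) ∈ s.1 := by
  obtain ⟨s, ⟨hs, hxy⟩, -⟩ := S.isPartition.2 (x, y)
  exact ⟨⟨s, hs⟩, hxy⟩

variable (S) in
/-- The element of the scheme `S` that contains the pair `(x, y)`. -/
noncomputable def rel (x y : X) : S.Elem := Classical.choose (S.exists_mem x y)

theorem mem_rel (x y : X) : (x, y) ∈ (S.rel x y).1 := Classical.choose_spec (S.exists_mem x y)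

theorem mem_iff_rel_eq {s : S.Elem} {x y : X} : (x, y) ∈ s.1 ↔ S.rel x y = s := by
  refine ⟨fun h => Subtype.ext ?_, fun h => h ▸ mem_rel x y⟩
  exact (S.isPartition.2 (x, y)).unique ⟨(S.rel x y).2, mem_rel x y⟩ ⟨s.2, h⟩

theorem exists_rel_eq (s : S.Elem) : ∃ x y, S.rel x y = s := by
  obtain ⟨⟨x, y⟩, h⟩ : s.1.Nonempty :=
    Set.nonempty_iff_ne_empty.2 fun h => S.isPartition.1 (h ▸ s.2)
  exact ⟨x, y, mem_iff_rel_eq.1 h⟩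

theorem nonempty_points (S : AssociationScheme X) : Nonempty X :=
  (exists_rel_eq S.one).nonempty

theorem rel_eq_one_iff {x y : X} : S.rel x y = S.one ↔ x = y :=
  mem_iff_rel_eq.symm

@[simp] theorem rel_self (x : X) : S.rel x x = S.one := rel_eq_one_iff.2 rfl

@[simp] theorem star_rel (x y : X) : S.star (S.rel x y) = S.rel y x :=
  (mem_iff_rel_eq.1 (show (y, x) ∈ (S.star (S.rel x y)).1 from mem_rel x y)).symm

@[simp] theorem star_star (s : S.Elem) : S.star (S.star s) = s := rfl

theorem star_eq_iff {s t : S.Elem} : S.star s = t ↔ s = S.star t :=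
  ⟨fun h => h ▸ rfl, fun h => h ▸ rfl⟩

theorem rel_eq_star_iff {s : S.Elem} {x y : X} : S.rel x y = S.star s ↔ S.rel y x = s := by
  rw [← star_eq_iff, star_rel]

theorem ncard_rel (p q : S.Elem) (x z : X) :
    {w | S.rel x w = p ∧ S.rel w z = q}.ncard = S.structConst p q (S.rel x z) := by
  rw [← S.structConst_spec p q _ (mem_rel x z)]
  simp only [mem_iff_rel_eq]

theorem structConst_rel_ne_zero {p q : S.Elem} {x z : X} :
    S.structConst p q (S.rel x z) ≠ 0 ↔ ∃ w, S.rel x w = p ∧ S.rel w z = q := by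
  rw [← ncard_rel, Ne, Set.ncard_eq_zero, ← Ne, ← Set.nonempty_iff_ne_empty]
  rfl

theorem subset_of_rel_mem {P Q : Set S.Elem} (h : ∀ x y, S.rel x y ∈ P → S.rel x y ∈ Q) :
    P ⊆ Q := fun s hs => by
  obtain ⟨x, y, rfl⟩ := exists_rel_eq s
  exact h x y hs

theorem ext_rel_mem {P Q : Set S.Elem} (h : ∀ x y, S.rel x y ∈ P ↔ S.rel x y ∈ Q) : P = Q :=
  Set.Subset.antisymm (subset_of_rel_mem fun x y => (h x y).1)
    (subset_of_rel_mem fun x y => (h x y).2)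

theorem rel_mem_star_image {P : Set S.Elem} {x y : X} :
    S.rel x y ∈ S.star '' P ↔ S.rel y x ∈ P :=
  ⟨by rintro ⟨s, hs, h⟩; rwa [← star_rel, ← h], fun h => ⟨_, h, star_rel y x⟩⟩

end Relations

section ComplexProduct

theorem rel_mem_complexMul {P Q : Set S.Elem} {x z : X} :
    S.rel x z ∈ S.complexMul P Q ↔ ∃ w, S.rel x w ∈ P ∧ S.rel w z ∈ Q := by
  constructor
  · rintro ⟨p, hp, q, hq, h⟩
    obtain ⟨w, rfl, rfl⟩ := structConst_rel_ne_zero.1 h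
    exact ⟨w, hp, hq⟩
  · rintro ⟨w, hp, hq⟩
    exact ⟨_, hp, _, hq, structConst_rel_ne_zero.2 ⟨w, rfl, rfl⟩⟩

theorem exists_rel_eq_right (x : X) (s : S.Elem) : ∃ y, S.rel x y = s := by
  obtain ⟨a, b, rfl⟩ := exists_rel_eq s
  have hone : S.rel a a ∈ S.complexMul {S.rel a b} {S.rel b a} :=
    rel_mem_complexMul.2 ⟨b, rfl, rfl⟩
  rw [rel_self, ← rel_self x] at hone
  obtain ⟨y, hy, -⟩ := rel_mem_complexMul.1 hone
  exact ⟨y, hy⟩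

/-- `P * Q` stands for the complex product of subsets of `S`, and `1` for the subset `{1}`. -/
noncomputable instance : Monoid (Set S.Elem) where
  mul := S.complexMul
  one := {S.one}
  mul_assoc P Q R := by
    refine ext_rel_mem fun x y => ?_
    change _ ∈ S.complexMul (S.complexMul P Q) R ↔ _ ∈ S.complexMul P (S.complexMul Q R)
    simp only [rel_mem_complexMul]
    exact ⟨fun ⟨w, ⟨v, hP, hQ⟩, hR⟩ => ⟨v, hP, w, hQ, hR⟩,
      fun ⟨v, hP, w, hQ, hR⟩ => ⟨w, ⟨v, hP, hQ⟩, hR⟩⟩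
  one_mul P := ext_rel_mem fun x y => by
    change _ ∈ S.complexMul {S.one} P ↔ _
    simp [rel_mem_complexMul, rel_eq_one_iff]
  mul_one P := ext_rel_mem fun x y => by
    change _ ∈ S.complexMul P {S.one} ↔ _
    simp [rel_mem_complexMul, rel_eq_one_iff]

theorem conj_eq_mul (s : S.Elem) (P : Set S.Elem) : S.conj s P = {S.star s} * P * {s} := rfl

theorem rel_mem_mul {P Q : Set S.Elem} {x z : X} :
    S.rel x z ∈ P * Q ↔ ∃ w, S.rel x w ∈ P ∧ S.rel w z ∈ Q := rel_mem_complexMul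

theorem mul_subset_mul {P P' Q Q' : Set S.Elem} (hP : P ⊆ P') (hQ : Q ⊆ Q') :
    P * Q ⊆ P' * Q' :=
  fun _ ⟨p, hp, q, hq, h⟩ => ⟨p, hP hp, q, hQ hq, h⟩

theorem star_image_mul (P Q : Set S.Elem) : S.star '' (P * Q) = S.star '' Q * S.star '' P := by
  refine ext_rel_mem fun x y => ?_
  simp only [rel_mem_star_image, rel_mem_mul, and_comm]

theorem star_image_star_image (P : Set S.Elem) : S.star '' (S.star '' P) = P :=
  ext_rel_mem fun x y => by simp only [rel_mem_star_image]

theorem mul_nonempty {P Q : Set S.Elem} (hP : P.Nonempty) (hQ : Q.Nonempty) :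
    (P * Q).Nonempty := by
  obtain ⟨p, hp⟩ := hP
  obtain ⟨q, hq⟩ := hQ
  obtain ⟨x, y, rfl⟩ := exists_rel_eq p
  obtain ⟨z, rfl⟩ := exists_rel_eq_right y q
  exact ⟨S.rel x z, rel_mem_mul.2 ⟨y, hp, hq⟩⟩

theorem one_subset_star_image_mul_self {P : Set S.Elem} (hP : P.Nonempty) :
    1 ⊆ S.star '' P * P := by
  obtain ⟨p, hp⟩ := hP
  obtain ⟨x, y, rfl⟩ := exists_rel_eq p
  rintro _ rfl
  exact rel_self (S := S) y ▸ rel_mem_mul.2 ⟨x, rel_mem_star_image.2 hp, hp⟩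

theorem one_subset_star_mul (s : S.Elem) : 1 ⊆ ({S.star s} * {s} : Set S.Elem) := by
  simpa only [Set.image_singleton] using one_subset_star_image_mul_self (Set.singleton_nonempty s)

theorem mem_mul_star_of_mem_mul {p q r : S.Elem} (h : r ∈ ({p} * {q} : Set S.Elem)) :
    p ∈ ({r} * {S.star q} : Set S.Elem) := by
  obtain ⟨x, y, rfl⟩ := exists_rel_eq r
  obtain ⟨w, rfl, rfl⟩ := rel_mem_mul.1 h
  exact rel_mem_mul.2 ⟨y, rfl, (star_rel w y).symm⟩

theorem mem_mul_of_mem_star_mul {p q r : S.Elem} (h : r ∈ ({S.star p} * {q} : Set S.Elem)) :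
    q ∈ ({p} * {r} : Set S.Elem) := by
  obtain ⟨x, y, rfl⟩ := exists_rel_eq r
  obtain ⟨w, hp, rfl⟩ := rel_mem_mul.1 h
  exact rel_mem_mul.2 ⟨x, rel_eq_star_iff.1 hp, rfl⟩

theorem exists_mem_of_mem_mul {P Q : Set S.Elem} {r : S.Elem} (h : r ∈ P * Q) :
    ∃ p ∈ P, ∃ q ∈ Q, r ∈ ({p} * {q} : Set S.Elem) := by
  obtain ⟨p, hp, q, hq, h⟩ := h
  exact ⟨p, hp, q, hq, p, rfl, q, rfl, h⟩

end ComplexProduct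

section ClosedSubsets

variable {P Q T : Set S.Elem}

theorem isClosedSubset_iff : S.IsClosedSubset P ↔ P.Nonempty ∧ S.star '' P * P ⊆ P := by
  refine and_congr_right fun _ => ⟨fun h r hr => ?_, fun h p hp q hq => ?_⟩
  · obtain ⟨_, ⟨p, hp, rfl⟩, q, hq, hr⟩ := exists_mem_of_mem_mul hr
    exact h p hp q hq hr
  · exact (mul_subset_mul (Set.singleton_subset_iff.2 (Set.mem_image_of_mem S.star hp))
      (Set.singleton_subset_iff.2 hq)).trans h

namespace IsClosedSubset

theorem star_image_mul_self_subset (hP : S.IsClosedSubset P) : S.star '' P * P ⊆ P :=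
  (isClosedSubset_iff.1 hP).2

theorem one_subset (hP : S.IsClosedSubset P) : 1 ⊆ P :=
  (one_subset_star_image_mul_self hP.1).trans hP.star_image_mul_self_subset

theorem one_mem (hP : S.IsClosedSubset P) : S.one ∈ P := hP.one_subset rfl

theorem star_image (hP : S.IsClosedSubset P) : S.star '' P = P := by
  have hsub : S.star '' P ⊆ P := calc
    S.star '' P = S.star '' P * 1 := (mul_one _).symm
    _ ⊆ S.star '' P * P := mul_subset_mul subset_rfl hP.one_subset
    _ ⊆ P := hP.star_image_mul_self_subset
  refine hsub.antisymm ?_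
  simpa only [star_image_star_image] using Set.image_mono (f := S.star) hsub

theorem mul_self (hP : S.IsClosedSubset P) : P * P = P := by
  refine Set.Subset.antisymm ?_ ?_
  · simpa only [hP.star_image] using hP.star_image_mul_self_subset
  · calc
      P = 1 * P := (one_mul P).symm
      _ ⊆ P * P := mul_subset_mul hP.one_subset subset_rfl

theorem mul_subset (hP : S.IsClosedSubset P) {Q R : Set S.Elem} (hQ : Q ⊆ P) (hR : R ⊆ P) :
    Q * R ⊆ P :=
  (mul_subset_mul hQ hR).trans hP.mul_self.subset

theorem star_mem (hP : S.IsClosedSubset P) {s : S.Elem} (hs : s ∈ P) : S.star s ∈ P :=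
  hP.star_image ▸ Set.mem_image_of_mem S.star hs

theorem rel_symm (hP : S.IsClosedSubset P) {x y : X} (h : S.rel x y ∈ P) : S.rel y x ∈ P :=
  star_rel x y ▸ hP.star_mem h

theorem rel_trans (hP : S.IsClosedSubset P) {x y z : X} (hxy : S.rel x y ∈ P)
    (hyz : S.rel y z ∈ P) : S.rel x z ∈ P :=
  hP.mul_self ▸ rel_mem_mul.2 ⟨y, hxy, hyz⟩

theorem rel_mem_iff_left (hP : S.IsClosedSubset P) {x y z : X} (hxy : S.rel x y ∈ P) :
    S.rel x z ∈ P ↔ S.rel y z ∈ P :=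
  ⟨hP.rel_trans (hP.rel_symm hxy), hP.rel_trans hxy⟩

theorem rel_mem_iff_right (hP : S.IsClosedSubset P) {x y z : X} (hyz : S.rel y z ∈ P) :
    S.rel x y ∈ P ↔ S.rel x z ∈ P :=
  ⟨(hP.rel_trans · hyz), (hP.rel_trans · (hP.rel_symm hyz))⟩

variable (S) in
theorem univ : S.IsClosedSubset Set.univ :=
  ⟨⟨S.one, Set.mem_univ _⟩, fun _ _ _ _ => Set.subset_univ _⟩

theorem inter (hP : S.IsClosedSubset P) (hQ : S.IsClosedSubset Q) : S.IsClosedSubset (P ∩ Q) :=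
  ⟨⟨S.one, hP.one_mem, hQ.one_mem⟩, fun p hp q hq =>
    Set.subset_inter (hP.2 p hp.1 q hq.1) (hQ.2 p hp.2 q hq.2)⟩

end IsClosedSubset

end ClosedSubsets

section Valency

theorem valency_eq_ncard (s : S.Elem) (x : X) : S.valency s = {y | S.rel x y = s}.ncard := by
  rw [valency, ← rel_self x, ← ncard_rel]
  simp only [rel_eq_star_iff, and_self]

theorem setValency_eq_ncard (T : Set S.Elem) (x : X) :
    S.setValency T = {y | S.rel x y ∈ T}.ncard := by
  have hfiber : {y | S.rel x y ∈ T} = ⋃ t ∈ T, {y | S.rel x y = t} := by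
    ext y
    simp
  have hdisj : T.PairwiseDisjoint fun t => {y | S.rel x y = t} := fun t _ t' _ h =>
    Set.disjoint_left.2 fun y hy hy' => h (hy.symm.trans hy')
  rw [hfiber, Set.Finite.ncard_biUnion (Set.toFinite T) (fun _ _ => Set.toFinite _) hdisj]
  simp only [setValency, valency_eq_ncard _ x]

theorem eq_of_subset_of_setValency_le {T U : Set S.Elem} (h : T ⊆ U)
    (hle : S.setValency U ≤ S.setValency T) : T = U := by
  obtain ⟨x⟩ := S.nonempty_points
  rw [setValency_eq_ncard T x, setValency_eq_ncard U x] at hle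
  have hsub : {y | S.rel x y ∈ T} ⊆ {y | S.rel x y ∈ U} := fun y hy => h hy
  have heq : {y | S.rel x y ∈ T} = {y | S.rel x y ∈ U} := Set.eq_of_subset_of_ncard_le hsub hle
  refine h.antisymm fun u hu => ?_
  obtain ⟨y, rfl⟩ := exists_rel_eq_right x u
  exact heq.symm.subset hu

theorem setValency_pos {T : Set S.Elem} (hT : T.Nonempty) : 0 < S.setValency T := by
  obtain ⟨x⟩ := S.nonempty_points
  obtain ⟨t, ht⟩ := hT
  obtain ⟨y, rfl⟩ := exists_rel_eq_right x t
  rw [setValency_eq_ncard T x, Set.ncard_pos]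
  exact ⟨y, ht⟩

theorem setValency_singleton (s : S.Elem) : S.setValency {s} = S.valency s :=
  finsum_mem_singleton

theorem setValency_one : S.setValency {S.one} = 1 := by
  obtain ⟨x⟩ := S.nonempty_points
  simp [setValency_eq_ncard _ x, rel_eq_one_iff]

theorem ncard_eq_ncard_image_mul {α β : Type*} [Finite α] {s : Set α} (f : α → β) {c : ℕ}
    (h : ∀ y ∈ s, {z | z ∈ s ∧ f z = f y}.ncard = c) : s.ncard = (f '' s).ncard * c := by
  classical
  have := Fintype.ofFinite α
  rw [Set.ncard_eq_toFinset_card' s, Finset.card_eq_sum_card_image f,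
    Finset.sum_const_nat (m := c), ← Set.ncard_coe_finset, Finset.coe_image, Set.coe_toFinset]
  intro b hb
  obtain ⟨y, hy, rfl⟩ := Finset.mem_image.1 hb
  rw [← h y (Set.mem_toFinset.1 hy), Set.ncard_eq_toFinset_card']
  congr 1
  ext z
  simp

namespace IsClosedSubset

variable {T U : Set S.Elem}

theorem setValency_dvd (hT : S.IsClosedSubset T) (hU : S.IsClosedSubset U) (h : T ⊆ U) :
    S.setValency T ∣ S.setValency U := by
  obtain ⟨x⟩ := S.nonempty_points
  rw [setValency_eq_ncard U x, ncard_eq_ncard_image_mul (fun y => {z | S.rel y z ∈ T})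
    (c := S.setValency T)]
  · exact dvd_mul_left _ _
  · intro y hy
    rw [setValency_eq_ncard T y]
    congr 1
    ext z
    refine ⟨fun ⟨_, hz⟩ => ?_, fun hz => ⟨hU.rel_trans hy (h hz), ?_⟩⟩
    · have hzz : S.rel z z ∈ T := by simpa only [rel_self] using hT.one_mem
      exact hz.subset hzz
    · ext w
      exact (hT.rel_mem_iff_left hz).symm

theorem setValency_eq_mul_index (hT : S.IsClosedSubset T) (hU : S.IsClosedSubset U) (h : T ⊆ U) :
    S.setValency U = S.setValency T * S.index T U :=
  (Nat.mul_div_cancel' (hT.setValency_dvd hU h)).symm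

end IsClosedSubset

end Valency

end AssociationScheme

namespace AssociationScheme

section AdjacencyMatrices

variable {X : Type u} [Fintype X] {S : AssociationScheme X}

/-- The adjacency matrix of `S` with weight `f s` on each `s`, that is, `∑ f(s) A_s` where `A_s` is
the adjacency matrix of the relation `s`. Subsets of `S` are encoded by their indicator
functions. -/
noncomputable def adjMatrix (f : S.Elem → ℕ) : Matrix X X ℕ := Matrix.of fun x y => f (S.rel x y)

theorem adjMatrix_apply (f : S.Elem → ℕ) (x y : X) : adjMatrix f x y = f (S.rel x y) := rfl

theorem adjMatrix_mul_apply (f g : S.Elem → ℕ) (x z : X) :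
    (adjMatrix f * adjMatrix g) x z =
      ∑ᶠ pq : S.Elem × S.Elem, S.structConst pq.1 pq.2 (S.rel x z) * (f pq.1 * g pq.2) := by
  classical
  have := Fintype.ofFinite S.Elem
  rw [Matrix.mul_apply, finsum_eq_sum_of_fintype]
  refine (Finset.sum_fiberwise' _ (fun w => (S.rel x w, S.rel w z)) fun pq =>
    f pq.1 * g pq.2).symm.trans (Finset.sum_congr rfl fun pq _ => ?_)
  rw [Finset.sum_const, smul_eq_mul, ← ncard_rel, ← Set.ncard_coe_finset]
  simp only [Finset.coe_filter_univ, Prod.ext_iff]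

theorem support_subset_of_adjMatrix_eq_mul {f g h : S.Elem → ℕ}
    (hfg : adjMatrix h = adjMatrix f * adjMatrix g) :
    Function.support h ⊆ Function.support f * Function.support g := by
  refine subset_of_rel_mem fun x z hne => ?_
  rw [Function.mem_support, ← adjMatrix_apply h, hfg] at hne
  obtain ⟨w, -, hw⟩ := Finset.exists_ne_zero_of_sum_ne_zero hne
  exact rel_mem_mul.2 ⟨w, left_ne_zero_of_mul hw, right_ne_zero_of_mul hw⟩

theorem exists_adjMatrix_eq_mul (f g : S.Elem → ℕ) :
    ∃ h : S.Elem → ℕ, adjMatrix h = adjMatrix f * adjMatrix g :=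
  ⟨fun r => ∑ᶠ pq : S.Elem × S.Elem, S.structConst pq.1 pq.2 r * (f pq.1 * g pq.2),
    Matrix.ext fun x z => (adjMatrix_mul_apply f g x z).symm⟩

theorem adjMatrix_indicator_mulVec_one (P : Set S.Elem) :
    (adjMatrix (P.indicator 1)).mulVec 1 = fun _ => S.setValency P := by
  classical
  ext x
  rw [setValency_eq_ncard P x, Set.ncard_eq_toFinset_card']
  simp [Matrix.mulVec, dotProduct, adjMatrix_apply, Set.indicator_apply]

variable {P Q : Set S.Elem}

theorem IsClosedSubset.adjMatrix_mul_apply_eq (hP : S.IsClosedSubset P) (M : Matrix X X ℕ)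
    {x x' : X} (h : S.rel x x' ∈ P) (y : X) :
    (adjMatrix (P.indicator 1) * M) x y = (adjMatrix (P.indicator 1) * M) x' y := by
  have hrow : adjMatrix (P.indicator 1) x = adjMatrix (P.indicator 1) x' := funext fun w => by
    classical simp only [adjMatrix_apply, Set.indicator_apply, hP.rel_mem_iff_left h, Pi.one_apply]
  rw [Matrix.mul_apply, Matrix.mul_apply, hrow]

theorem IsClosedSubset.mul_adjMatrix_apply_eq (hQ : S.IsClosedSubset Q) (M : Matrix X X ℕ)
    {y y' : X} (h : S.rel y y' ∈ Q) (x : X) :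
    (M * adjMatrix (Q.indicator 1)) x y = (M * adjMatrix (Q.indicator 1)) x y' := by
  have hcol (w : X) : adjMatrix (Q.indicator 1) w y = adjMatrix (Q.indicator 1) w y' := by
    classical simp only [adjMatrix_apply, Set.indicator_apply, hQ.rel_mem_iff_right h, Pi.one_apply]
  simp only [Matrix.mul_apply, hcol]

theorem exists_adjMatrix_mul_mul_eq_smul (hP : S.IsClosedSubset P) (hQ : S.IsClosedSubset Q)
    (u : S.Elem) :
    ∃ c : ℕ, adjMatrix (P.indicator 1) * adjMatrix (Set.indicator {u} 1) *
      adjMatrix (Q.indicator 1) = c • adjMatrix ((P * {u} * Q).indicator 1) := by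
  obtain ⟨f, hf⟩ := exists_adjMatrix_eq_mul (P.indicator 1) (Set.indicator {u} 1)
  obtain ⟨h, hh⟩ := exists_adjMatrix_eq_mul f (Q.indicator 1)
  have hsupp : Function.support h ⊆ P * {u} * Q := by
    refine (support_subset_of_adjMatrix_eq_mul hh).trans (mul_subset_mul
      ((support_subset_of_adjMatrix_eq_mul hf).trans (mul_subset_mul ?_ ?_)) ?_) <;>
    exact Set.support_indicator_subset
  have hconst {d : S.Elem} (hd : d ∈ P * {u} * Q) : h d = h u := by
    obtain ⟨x, y, rfl⟩ := exists_rel_eq d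
    obtain ⟨b, hb, hby⟩ := rel_mem_mul.1 hd
    obtain ⟨a, hxa, rfl⟩ := rel_mem_mul.1 hb
    rw [← adjMatrix_apply h, ← adjMatrix_apply h, hh, ← hQ.mul_adjMatrix_apply_eq _ hby, hf,
      Matrix.mul_assoc, hP.adjMatrix_mul_apply_eq _ hxa]
  refine ⟨h u, ?_⟩
  rw [← hf, ← hh]
  ext x y
  by_cases hd : S.rel x y ∈ P * {u} * Q
  · simp [adjMatrix_apply, hd, hconst hd]
  · simp [adjMatrix_apply, hd, Function.notMem_support.1 fun hxy => hd (hsupp hxy)]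

end AdjacencyMatrices

section DoubleCosets

variable {X : Type u} [Finite X] {S : AssociationScheme X} {P Q : Set S.Elem}

-- Compare the row sums of `A_P A_u A_Q` and of a multiple of the indicator of `PuQ`.
theorem setValency_mul_mul_dvd (hP : S.IsClosedSubset P) (hQ : S.IsClosedSubset Q) (u : S.Elem) :
    S.setValency (P * {u} * Q) ∣ S.setValency P * S.valency u * S.setValency Q := by
  have := Fintype.ofFinite X
  obtain ⟨x⟩ := S.nonempty_points
  obtain ⟨c, hc⟩ := exists_adjMatrix_mul_mul_eq_smul hP hQ u
  have hconst (A : Set S.Elem) (n : ℕ) : (adjMatrix (A.indicator 1)).mulVec (fun _ => n) =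
      fun _ => S.setValency A * n := by
    rw [show (fun _ => n : X → ℕ) = n • 1 from funext fun _ => (mul_one n).symm,
      Matrix.mulVec_smul, adjMatrix_indicator_mulVec_one]
    exact funext fun _ => mul_comm _ _
  refine ⟨c, ?_⟩
  have hx := congrFun (congrArg (Matrix.mulVec · 1) hc) x
  simp only [← Matrix.mulVec_mulVec, Matrix.smul_mulVec, adjMatrix_indicator_mulVec_one,
    hconst, setValency_singleton] at hx
  rw [mul_assoc, hx]
  exact mul_comm _ _

end DoubleCosets

end AssociationScheme

namespace AssociationScheme

variable {X : Type u} [Finite X] {S : AssociationScheme X}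

section Conjugation

variable {P Q : Set S.Elem} {t : S.Elem}

theorem conj_subset_conj (h : P ⊆ Q) : S.conj t P ⊆ S.conj t Q :=
  mul_subset_mul (mul_subset_mul subset_rfl h) subset_rfl

theorem one_subset_conj (h : 1 ⊆ P) : 1 ⊆ S.conj t P := calc
  (1 : Set S.Elem) ⊆ {S.star t} * {t} := one_subset_star_mul t
  _ = {S.star t} * 1 * {t} := by rw [mul_one]
  _ ⊆ S.conj t P := conj_subset_conj h

theorem subset_conj_conj_star (t : S.Elem) (P : Set S.Elem) :
    P ⊆ S.conj t (S.conj (S.star t) P) := calc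
  P = 1 * P * 1 := by rw [one_mul, mul_one]
  _ ⊆ {S.star t} * {t} * P * ({S.star t} * {t}) := mul_subset_mul
    (mul_subset_mul (one_subset_star_mul t) subset_rfl) (one_subset_star_mul t)
  _ = S.conj t (S.conj (S.star t) P) := by simp only [conj_eq_mul, star_star, mul_assoc]

theorem star_mul_subset_of_conj_subset (hP : 1 ⊆ P) (h : S.conj t P ⊆ Q) :
    ({S.star t} * {t} : Set S.Elem) ⊆ Q := calc
  ({S.star t} * {t} : Set S.Elem) = S.conj t 1 := by rw [conj_eq_mul, mul_one]
  _ ⊆ Q := (conj_subset_conj hP).trans h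

theorem mul_subset_mul_conj (t : S.Elem) (P : Set S.Elem) : P * {t} ⊆ {t} * S.conj t P := calc
  P * {t} = 1 * (P * {t}) := (one_mul _).symm
  _ ⊆ {t} * {S.star t} * (P * {t}) := mul_subset_mul (one_subset_star_mul (S.star t)) subset_rfl
  _ = {t} * S.conj t P := by simp only [conj_eq_mul, mul_assoc]

theorem mul_subset_conj_star_mul (t : S.Elem) (P : Set S.Elem) :
    {t} * P ⊆ S.conj (S.star t) P * {t} := calc
  {t} * P = {t} * P * 1 := (mul_one _).symm
  _ ⊆ {t} * P * ({S.star t} * {t}) := mul_subset_mul subset_rfl (one_subset_star_mul t)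
  _ = S.conj (S.star t) P * {t} := by simp only [conj_eq_mul, star_star, mul_assoc]

theorem singleton_mul_subset_of_mem {p q : S.Elem} (ht : ({S.star t} * {t} : Set S.Elem) ⊆ P)
    (hq : q ∈ ({p} * {t} : Set S.Elem)) :
    ({p} * {t} : Set S.Elem) ⊆ {q} * P := calc
  ({p} * {t} : Set S.Elem) ⊆ {q} * {S.star t} * {t} :=
    mul_subset_mul (Set.singleton_subset_iff.2 (mem_mul_star_of_mem_mul hq)) subset_rfl
  _ = {q} * ({S.star t} * {t}) := mul_assoc _ _ _
  _ ⊆ {q} * P := mul_subset_mul subset_rfl ht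

end Conjugation

namespace IsStronglyNormalIn

variable {P T : Set S.Elem} {t : S.Elem}

theorem commute (hPT : S.IsStronglyNormalIn P T) (hT : S.IsClosedSubset T) (ht : t ∈ T) :
    Commute {t} P :=
  Set.Subset.antisymm
    ((mul_subset_conj_star_mul t P).trans
      (mul_subset_mul (hPT.2 _ (hT.star_mem ht)) subset_rfl))
    ((mul_subset_mul_conj t P).trans (mul_subset_mul subset_rfl (hPT.2 t ht)))

theorem star_mul_subset (hPT : S.IsStronglyNormalIn P T) (hP : S.IsClosedSubset P) (ht : t ∈ T) :
    ({S.star t} * {t} : Set S.Elem) ⊆ P :=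
  star_mul_subset_of_conj_subset hP.one_subset (hPT.2 t ht)

end IsStronglyNormalIn

section DoubleCosetStabilizer

variable {D : Set S.Elem}

theorem isClosedSubset_star_image_mul_self (hD : D.Nonempty) (h : D * (S.star '' D * D) ⊆ D) :
    S.IsClosedSubset (S.star '' D * D) := by
  refine isClosedSubset_iff.2 ⟨mul_nonempty (hD.image S.star) hD, ?_⟩
  rw [star_image_mul, star_image_star_image, mul_assoc]
  exact mul_subset_mul subset_rfl h

theorem setValency_star_image_mul_self (hD : D.Nonempty) (h : D * (S.star '' D * D) ⊆ D) :
    S.setValency (S.star '' D * D) = S.setValency D := by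
  obtain ⟨d, hd⟩ := hD
  obtain ⟨x, y, rfl⟩ := exists_rel_eq d
  rw [setValency_eq_ncard _ y, setValency_eq_ncard D x]
  congr 1
  ext z
  exact ⟨fun hz => h (rel_mem_mul.2 ⟨y, hd, hz⟩),
    fun hz => rel_mem_mul.2 ⟨x, rel_mem_star_image.2 hd, hz⟩⟩

end DoubleCosetStabilizer

section DoubleCosets

variable {P T U : Set S.Elem} {u d : S.Elem}

namespace IsClosedSubset

theorem doubleCoset_eq_of_mem (hP : S.IsClosedSubset P) (hd : d ∈ P * {u} * P) :
    P * {d} * P = P * {u} * P := by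
  have hsub {d u : S.Elem} (hd : d ∈ P * {u} * P) : P * {d} * P ⊆ P * {u} * P := calc
    P * {d} * P ⊆ P * (P * {u} * P) * P :=
      mul_subset_mul (mul_subset_mul subset_rfl (Set.singleton_subset_iff.2 hd)) subset_rfl
    _ = P * P * {u} * (P * P) := by simp only [mul_assoc]
    _ = P * {u} * P := by rw [hP.mul_self]
  refine (hsub hd).antisymm (hsub ?_)
  obtain ⟨x, y, rfl⟩ := exists_rel_eq d
  obtain ⟨b, hb, hby⟩ := rel_mem_mul.1 hd
  obtain ⟨a, hxa, rfl⟩ := rel_mem_mul.1 hb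
  exact rel_mem_mul.2 ⟨y, rel_mem_mul.2 ⟨x, hP.rel_symm hxa, rfl⟩, hP.rel_symm hby⟩

theorem star_image_mul_self_doubleCoset (hP : S.IsClosedSubset P) (u : S.Elem) :
    S.star '' (P * {u} * P) * (P * {u} * P) = P * S.conj u P * P := calc
  S.star '' (P * {u} * P) * (P * {u} * P) = P * {S.star u} * (P * P) * {u} * P := by
    simp only [star_image_mul, Set.image_singleton, hP.star_image, mul_assoc]
  _ = P * S.conj u P * P := by simp only [hP.mul_self, conj_eq_mul, mul_assoc]

theorem doubleCoset_nonempty (hP : S.IsClosedSubset P) (u : S.Elem) : (P * {u} * P).Nonempty :=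
  mul_nonempty (mul_nonempty hP.1 (Set.singleton_nonempty u)) hP.1

end IsClosedSubset

theorem IsStronglyNormalIn.doubleCoset_mul_subset (hPT : S.IsStronglyNormalIn P T)
    (hP : S.IsClosedSubset P) (hT : S.IsClosedSubset T) (hPu : P * S.conj u P * P ⊆ T) :
    P * {u} * P * (P * S.conj u P * P) ⊆ P * {u} * P := by
  intro r hr
  obtain ⟨c, hc, b, hb, hr⟩ := exists_mem_of_mem_mul hr
  have hbT : b ∈ T := hPu hb
  rw [← hP.star_image_mul_self_doubleCoset] at hb
  obtain ⟨_, ⟨d, hd, rfl⟩, e, he, hb⟩ := exists_mem_of_mem_mul hb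
  have hsub : P * {u} * P * {b} ⊆ P * {u} * P := calc
    P * {u} * P * {b} = P * ({d} * {b}) * P := by
      rw [← hP.doubleCoset_eq_of_mem hd, mul_assoc _ P, ← (hPT.commute hT hbT).eq]
      simp only [mul_assoc]
    _ ⊆ P * ({e} * P) * P := mul_subset_mul (mul_subset_mul subset_rfl
      (singleton_mul_subset_of_mem (hPT.star_mul_subset hP hbT)
        (mem_mul_of_mem_star_mul hb))) subset_rfl
    _ = P * {u} * P := by rw [← mul_assoc, mul_assoc, hP.mul_self, hP.doubleCoset_eq_of_mem he]
  exact hsub (mul_subset_mul (Set.singleton_subset_iff.2 hc) subset_rfl hr)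

theorem IsStronglyNormalIn.exists_doubleCoset_mul_subset (hPT : S.IsStronglyNormalIn P T)
    (hTU : S.IsStronglyNormalIn T U) (hP : S.IsClosedSubset P) (hT : S.IsClosedSubset T)
    (hU : S.IsClosedSubset U) (hu : u ∈ U) {g : S.Elem} (hg : g ∈ T) :
    ∃ h ∈ T, P * {u} * P * {g} ⊆ {h} * (P * {u} * P) := by
  obtain ⟨e, he⟩ : ({u} * {g} : Set S.Elem).Nonempty :=
    mul_nonempty (Set.singleton_nonempty u) (Set.singleton_nonempty g)
  have heT : e ∈ T * {u} := (hTU.commute hU hu).eq ▸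
    mul_subset_mul subset_rfl (Set.singleton_subset_iff.2 hg) he
  obtain ⟨h, hh, u', hu', he'⟩ := exists_mem_of_mem_mul heT
  rw [Set.mem_singleton_iff.1 hu'] at he'
  refine ⟨h, hh, ?_⟩
  calc P * {u} * P * {g} = P * ({u} * {g}) * P := by
        rw [mul_assoc _ P, ← (hPT.commute hT hg).eq]
        simp only [mul_assoc]
    _ ⊆ P * ({e} * P) * P := mul_subset_mul (mul_subset_mul subset_rfl
      (singleton_mul_subset_of_mem (hPT.star_mul_subset hP hg) he)) subset_rfl
    _ = P * {e} * P := by rw [← mul_assoc, mul_assoc, hP.mul_self]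
    _ ⊆ P * ({h} * {u}) * P := mul_subset_mul (mul_subset_mul subset_rfl
      (Set.singleton_subset_iff.2 he')) subset_rfl
    _ = {h} * (P * {u} * P) := by
        rw [← mul_assoc P, ← (hPT.commute hT hh).eq]
        simp only [mul_assoc]

theorem IsStronglyNormalIn.conj_mul_conj_mul_subset (hPT : S.IsStronglyNormalIn P T)
    (hTU : S.IsStronglyNormalIn T U) (hP : S.IsClosedSubset P) (hT : S.IsClosedSubset T)
    (hU : S.IsClosedSubset U) (hu : u ∈ U) {g : S.Elem} (hg : g ∈ T) :
    S.conj g (P * S.conj u P * P) ⊆ P * S.conj u P * P := by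
  obtain ⟨h, hh, hsub⟩ := hPT.exists_doubleCoset_mul_subset hTU hP hT hU hu hg
  rw [← hP.star_image_mul_self_doubleCoset]
  set D := P * {u} * P
  have hPD : P * D = D := by simp only [D, ← mul_assoc, hP.mul_self]
  calc S.conj g (S.star '' D * D) = S.star '' (D * {g}) * (D * {g}) := by
        simp only [conj_eq_mul, star_image_mul, Set.image_singleton, mul_assoc]
    _ ⊆ S.star '' ({h} * D) * ({h} * D) := mul_subset_mul (Set.image_mono hsub) hsub
    _ = S.star '' D * ({S.star h} * {h} * D) := by
        simp only [star_image_mul, Set.image_singleton, mul_assoc]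
    _ ⊆ S.star '' D * (P * D) :=
        mul_subset_mul subset_rfl (mul_subset_mul (hPT.star_mul_subset hP hh) subset_rfl)
    _ = S.star '' D * D := by rw [hPD]

theorem mul_conj_mul_subset (hT : S.IsClosedSubset T) (hTU : S.IsStronglyNormalIn T U)
    (hPT : P ⊆ T) (hu : u ∈ U) : P * S.conj u P * P ⊆ T :=
  hT.mul_subset (hT.mul_subset hPT ((conj_subset_conj hPT).trans (hTU.2 u hu))) hPT

theorem IsClosedSubset.subset_mul_conj_mul (hP : S.IsClosedSubset P) (u : S.Elem) :
    P ⊆ P * S.conj u P * P := calc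
  P = P * 1 * 1 := by simp only [mul_one]
  _ ⊆ P * S.conj u P * P :=
    mul_subset_mul (mul_subset_mul subset_rfl (one_subset_conj hP.one_subset)) hP.one_subset

theorem IsClosedSubset.conj_subset_mul_conj_mul (hP : S.IsClosedSubset P) (u : S.Elem) :
    S.conj u P ⊆ P * S.conj u P * P := calc
  S.conj u P = 1 * S.conj u P * 1 := by simp only [one_mul, mul_one]
  _ ⊆ P * S.conj u P * P :=
    mul_subset_mul (mul_subset_mul hP.one_subset subset_rfl) hP.one_subset

theorem IsStronglyNormalIn.mul_conj_mul (hPT : S.IsStronglyNormalIn P T)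
    (hTU : S.IsStronglyNormalIn T U) (hP : S.IsClosedSubset P) (hT : S.IsClosedSubset T)
    (hU : S.IsClosedSubset U) (hu : u ∈ U) : S.IsStronglyNormalIn (P * S.conj u P * P) T :=
  ⟨mul_conj_mul_subset hT hTU hPT.1 hu,
    fun _ hg => hPT.conj_mul_conj_mul_subset hTU hP hT hU hu hg⟩

theorem IsStronglyNormalIn.isClosedSubset_mul_conj_mul (hPT : S.IsStronglyNormalIn P T)
    (hP : S.IsClosedSubset P) (hT : S.IsClosedSubset T) (hPu : P * S.conj u P * P ⊆ T) :
    S.IsClosedSubset (P * S.conj u P * P) := by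
  have hstab := hPT.doubleCoset_mul_subset hP hT hPu
  rw [← hP.star_image_mul_self_doubleCoset] at hstab ⊢
  exact isClosedSubset_star_image_mul_self (hP.doubleCoset_nonempty u) hstab

theorem IsStronglyNormalIn.setValency_mul_conj_mul (hPT : S.IsStronglyNormalIn P T)
    (hP : S.IsClosedSubset P) (hT : S.IsClosedSubset T) (hPu : P * S.conj u P * P ⊆ T) :
    S.setValency (P * S.conj u P * P) = S.setValency (P * {u} * P) := by
  have hstab := hPT.doubleCoset_mul_subset hP hT hPu
  rw [← hP.star_image_mul_self_doubleCoset] at hstab ⊢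
  exact setValency_star_image_mul_self (hP.doubleCoset_nonempty u) hstab

end DoubleCosets

section MaximalPiSubsets

variable {π : Set ℕ} {P T U : Set S.Elem}

theorem IsStronglyNormalIn.of_maximalFor (hT : S.IsClosedSubset T) (hU : S.IsClosedSubset U)
    (hTU : S.IsStronglyNormalIn T U) (hval : S.IsPiValencedSubset π U)
    (hP : MaximalFor (fun Q => S.IsClosedSubset Q ∧ S.IsStronglyNormalIn Q T ∧
      IsPiNumber π (S.setValency Q)) S.setValency P) :
    S.IsStronglyNormalIn P U := by
  obtain ⟨⟨hPc, hPT, hPπ⟩, hmax⟩ := hP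
  refine ⟨hPT.1.trans hTU.1, fun u hu => ?_⟩
  have hPu : P * S.conj u P * P ⊆ T := mul_conj_mul_subset hT hTU hPT.1 hu
  have hBπ : IsPiNumber π (S.setValency (P * S.conj u P * P)) :=
    hPT.setValency_mul_conj_mul hPc hT hPu ▸
      ((hPπ.mul (hval u hu)).mul hPπ).of_dvd (setValency_mul_mul_dvd hPc hPc u)
  have hPB : P = P * S.conj u P * P := eq_of_subset_of_setValency_le
    (hPc.subset_mul_conj_mul u) ((le_total _ _).elim (hmax
      ⟨hPT.isClosedSubset_mul_conj_mul hPc hT hPu, hPT.mul_conj_mul hTU hPc hT hU hu, hBπ⟩) id)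
  exact (hPc.conj_subset_mul_conj_mul u).trans hPB.symm.subset

theorem IsClosedSubset.isStronglyNormalIn_self (hT : S.IsClosedSubset T) :
    S.IsStronglyNormalIn T T :=
  ⟨subset_rfl, fun _ ht => hT.mul_subset
    (hT.mul_subset (Set.singleton_subset_iff.2 (hT.star_mem ht)) subset_rfl)
    (Set.singleton_subset_iff.2 ht)⟩

theorem exists_isStronglyNormalIn_isPiNumber (hval : S.IsPiValenced π) {n : ℕ}
    {T : ℕ → Set S.Elem} (hT : ∀ i ≤ n, S.IsClosedSubset (T i)) (hzero : T 0 = {S.one})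
    (hnormal : ∀ i < n, S.IsStronglyNormalIn (T i) (T (i + 1))) :
    ∃ P, S.IsClosedSubset P ∧ S.IsStronglyNormalIn P (T n) ∧ IsPiNumber π (S.setValency P) := by
  induction n with
  | zero =>
    refine ⟨T 0, hT 0 le_rfl, (hT 0 le_rfl).isStronglyNormalIn_self, ?_⟩
    rw [hzero, setValency_one]
    exact isPiNumber_one π
  | succ n ih =>
    obtain ⟨P, hP⟩ := (Set.toFinite _).exists_maximalFor S.setValency
      {P | S.IsClosedSubset P ∧ S.IsStronglyNormalIn P (T n) ∧ IsPiNumber π (S.setValency P)}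
      (ih (fun i hi => hT i (by omega)) fun i hi => hnormal i (by omega))
    exact ⟨P, hP.1.1, .of_maximalFor (hT n (by omega)) (hT (n + 1) le_rfl) (hnormal n (by omega))
      (fun t _ => hval t trivial) hP, hP.1.2.2⟩

theorem exists_isStronglyNormalIn_isPiNumber_of_isSolvable (hS : S.IsSolvable)
    (hval : S.IsPiValenced π) :
    ∃ P, S.IsClosedSubset P ∧ S.IsStronglyNormalIn P Set.univ ∧ IsPiNumber π (S.setValency P) := by
  obtain ⟨n, T, hT, hzero, hn, hstep⟩ := hS
  exact hn ▸ exists_isStronglyNormalIn_isPiNumber hval hT hzero fun i hi => (hstep i hi).1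

end MaximalPiSubsets

/-- Morphisms from `S` to the group `G`, that is, maps compatible with composition of pairs;
equivalently, scheme morphisms to the thin scheme of `G`. -/
def IsGroupMorphism {G : Type*} [Group G] (φ : S.Elem → G) : Prop :=
  ∀ x y z, φ (S.rel x z) = φ (S.rel x y) * φ (S.rel y z)

section QuotientGroup

variable {P : Set S.Elem}

theorem IsClosedSubset.singleton_mul_eq_self_iff (hP : S.IsClosedSubset P) {s : S.Elem} :
    {s} * P = P ↔ s ∈ P := by
  have hs_mem : s ∈ {s} * P := mul_subset_mul subset_rfl hP.one_subset
    ((mul_one ({s} : Set S.Elem)).symm.subset rfl)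
  refine ⟨fun h => h.subset hs_mem, fun hs => Set.Subset.antisymm
    (hP.mul_subset (Set.singleton_subset_iff.2 hs) subset_rfl) ?_⟩
  calc P = 1 * P := (one_mul P).symm
    _ ⊆ {s} * {S.star s} * P := mul_subset_mul (one_subset_star_mul (S.star s)) subset_rfl
    _ = {s} * ({S.star s} * P) := mul_assoc _ _ _
    _ ⊆ {s} * P := mul_subset_mul subset_rfl
      (hP.mul_subset (Set.singleton_subset_iff.2 (hP.star_mem hs)) subset_rfl)

theorem IsStronglyNormalIn.leftCoset_mul_leftCoset (hn : S.IsStronglyNormalIn P Set.univ)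
    (hP : S.IsClosedSubset P) {s t r : S.Elem} (hr : r ∈ ({s} * {t} : Set S.Elem)) :
    {s} * P * ({t} * P) = {r} * P := by
  have hst : {s} * P * ({t} * P) = {s} * {t} * P := by
    rw [mul_assoc, ← mul_assoc P, ← (hn.commute (.univ S) (Set.mem_univ t)).eq]
    simp only [mul_assoc, hP.mul_self]
  rw [hst]
  refine Set.Subset.antisymm ?_ (mul_subset_mul (Set.singleton_subset_iff.2 hr) subset_rfl)
  calc {s} * {t} * P ⊆ {r} * P * P := mul_subset_mul
        (singleton_mul_subset_of_mem (hn.star_mul_subset hP (Set.mem_univ t)) hr) subset_rfl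
    _ = {r} * P := by rw [mul_assoc, hP.mul_self]

theorem IsStronglyNormalIn.star_image_leftCoset (hn : S.IsStronglyNormalIn P Set.univ)
    (hP : S.IsClosedSubset P) (s : S.Elem) : S.star '' ({s} * P) = {S.star s} * P := by
  rw [star_image_mul, hP.star_image, Set.image_singleton,
    (hn.commute (.univ S) (Set.mem_univ (S.star s))).eq]

/-- The set of left cosets `sP`; for strongly normal `P` it is a group under the complex product,
namely the (thin) quotient scheme `S // P`. -/
def LeftCosets (P : Set S.Elem) : Type u := Set.range fun s : S.Elem => {s} * P

instance : Finite (LeftCosets P) := inferInstanceAs (Finite (Set.range _))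

/-- The left coset `sP`. -/
def leftCoset (P : Set S.Elem) (s : S.Elem) : LeftCosets P := ⟨{s} * P, s, rfl⟩

theorem leftCoset_surjective (P : Set S.Elem) : Function.Surjective (leftCoset P) :=
  fun ⟨_, s, hs⟩ => ⟨s, Subtype.ext hs⟩

/-- The group structure on the left cosets of a strongly normal closed subset. -/
noncomputable abbrev IsStronglyNormalIn.groupLeftCosets (hn : S.IsStronglyNormalIn P Set.univ)
    (hP : S.IsClosedSubset P) : Group (LeftCosets P) :=
  letI : Mul (LeftCosets P) := ⟨fun c d => ⟨c.1 * d.1, by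
    obtain ⟨⟨_, s, rfl⟩, ⟨_, t, rfl⟩⟩ := c, d
    obtain ⟨r, hr⟩ := mul_nonempty (Set.singleton_nonempty s) (Set.singleton_nonempty t)
    exact ⟨r, (hn.leftCoset_mul_leftCoset hP hr).symm⟩⟩⟩
  letI : One (LeftCosets P) := ⟨leftCoset P S.one⟩
  letI : Inv (LeftCosets P) := ⟨fun c => ⟨S.star '' c.1, by
    obtain ⟨_, s, rfl⟩ := c
    exact ⟨S.star s, (hn.star_image_leftCoset hP s).symm⟩⟩⟩
  Group.ofLeftAxioms (fun _ _ _ => Subtype.ext (mul_assoc _ _ _))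
    (fun ⟨_, s, h⟩ => Subtype.ext <| h ▸
      hn.leftCoset_mul_leftCoset hP ((one_mul ({s} : Set S.Elem)).symm.subset rfl))
    (fun ⟨_, s, h⟩ => Subtype.ext <| h ▸
      (congrArg (· * ({s} * P)) (hn.star_image_leftCoset hP s)).trans
        (hn.leftCoset_mul_leftCoset hP (one_subset_star_mul s rfl)))

theorem IsStronglyNormalIn.isGroupMorphism_leftCoset (hn : S.IsStronglyNormalIn P Set.univ)
    (hP : S.IsClosedSubset P) :
    @IsGroupMorphism _ _ _ _ (hn.groupLeftCosets hP) (leftCoset P) := fun _ y _ =>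
  Subtype.ext (hn.leftCoset_mul_leftCoset hP (rel_mem_mul.2 ⟨y, rfl, rfl⟩)).symm

theorem IsStronglyNormalIn.leftCoset_preimage_one (hn : S.IsStronglyNormalIn P Set.univ)
    (hP : S.IsClosedSubset P) :
    letI := hn.groupLeftCosets hP
    leftCoset P ⁻¹' {1} = P := by
  ext s
  have hone : {S.one} * P = P := one_mul P
  refine Iff.trans ?_ hP.singleton_mul_eq_self_iff
  exact Subtype.ext_iff.trans (Eq.congr_right hone)

end QuotientGroup

namespace IsGroupMorphism

variable {G : Type*} [Group G] {φ : S.Elem → G}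

theorem map_one (hφ : IsGroupMorphism φ) : φ S.one = 1 := by
  obtain ⟨x⟩ := S.nonempty_points
  simpa only [rel_self, left_eq_mul] using hφ x x x

theorem map_rel_symm (hφ : IsGroupMorphism φ) (x y : X) :
    φ (S.rel y x) = (φ (S.rel x y))⁻¹ := by
  rw [eq_inv_iff_mul_eq_one, ← hφ, rel_self, hφ.map_one]

theorem map_star (hφ : IsGroupMorphism φ) (s : S.Elem) : φ (S.star s) = (φ s)⁻¹ := by
  obtain ⟨x, y, rfl⟩ := exists_rel_eq s
  rw [star_rel, hφ.map_rel_symm]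

theorem map_of_mem_mul (hφ : IsGroupMorphism φ) {s t r : S.Elem}
    (hr : r ∈ ({s} * {t} : Set S.Elem)) : φ r = φ s * φ t := by
  obtain ⟨x, z, rfl⟩ := exists_rel_eq r
  obtain ⟨y, rfl, rfl⟩ := rel_mem_mul.1 hr
  exact hφ x y z

theorem exists_map_eq_conj (hφ : IsGroupMorphism φ) {T : Set S.Elem} {s r : S.Elem}
    (hr : r ∈ S.conj s T) : ∃ t ∈ T, φ r = MulAut.conj (φ s)⁻¹ (φ t) := by
  rw [conj_eq_mul, mul_assoc] at hr
  obtain ⟨_, rfl, q, hq, hrq⟩ := exists_mem_of_mem_mul hr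
  obtain ⟨t, ht, _, rfl, hqt⟩ := exists_mem_of_mem_mul hq
  refine ⟨t, ht, ?_⟩
  rw [hφ.map_of_mem_mul hrq, hφ.map_of_mem_mul hqt, hφ.map_star, MulAut.conj_apply, inv_inv,
    mul_assoc]

/-- The image of a closed subset of `S`, as a subgroup of `G`. -/
def image (hφ : IsGroupMorphism φ) {T : Set S.Elem} (hT : S.IsClosedSubset T) : Subgroup G where
  carrier := φ '' T
  one_mem' := ⟨S.one, hT.one_mem, hφ.map_one⟩
  mul_mem' := by
    rintro _ _ ⟨s, hs, rfl⟩ ⟨t, ht, rfl⟩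
    obtain ⟨r, hr⟩ := mul_nonempty (Set.singleton_nonempty s) (Set.singleton_nonempty t)
    exact ⟨r, hT.mul_subset (Set.singleton_subset_iff.2 hs) (Set.singleton_subset_iff.2 ht) hr,
      hφ.map_of_mem_mul hr⟩
  inv_mem' := by
    rintro _ ⟨s, hs, rfl⟩
    exact ⟨S.star s, hT.star_mem hs, hφ.map_star s⟩

theorem isClosedSubset_preimage (hφ : IsGroupMorphism φ) (H : Subgroup G) :
    S.IsClosedSubset (φ ⁻¹' H) := by
  refine ⟨⟨S.one, by rw [Set.mem_preimage, hφ.map_one]; exact H.one_mem⟩, fun p hp q hq r hr => ?_⟩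
  rw [Set.mem_preimage, hφ.map_of_mem_mul hr, hφ.map_star]
  exact H.mul_mem (H.inv_mem hp) hq

theorem image_preimage (hφ : IsGroupMorphism φ) (hsurj : Function.Surjective φ) (H : Subgroup G) :
    hφ.image (hφ.isClosedSubset_preimage H) = H :=
  SetLike.coe_injective (Set.image_preimage_eq _ hsurj)

theorem isClosedSubset_preimage_one (hφ : IsGroupMorphism φ) : S.IsClosedSubset (φ ⁻¹' {1}) :=
  hφ.isClosedSubset_preimage ⊥

section Conjugates

theorem conj_subset_preimage (hφ : IsGroupMorphism φ) {T : Set S.Elem} {H : Subgroup G}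
    (h : T ⊆ φ ⁻¹' H) (s : S.Elem) :
    S.conj s T ⊆ φ ⁻¹' (MulAut.conj (φ s)⁻¹ • H : Subgroup G) := by
  intro r hr
  obtain ⟨t, ht, hrt⟩ := hφ.exists_map_eq_conj hr
  rw [Set.mem_preimage, hrt]
  exact Subgroup.smul_mem_pointwise_smul _ _ H (h ht)

theorem conj_preimage (hφ : IsGroupMorphism φ) (H : Subgroup G) (s : S.Elem) :
    S.conj s (φ ⁻¹' H) = φ ⁻¹' (MulAut.conj (φ s)⁻¹ • H : Subgroup G) := by
  refine (hφ.conj_subset_preimage subset_rfl s).antisymm ?_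
  have hback := hφ.conj_subset_preimage (H := MulAut.conj (φ s)⁻¹ • H) subset_rfl (S.star s)
  rw [hφ.map_star, inv_inv, smul_smul, ← map_mul, mul_inv_cancel, _root_.map_one, one_smul] at hback
  exact (subset_conj_conj_star s _).trans (conj_subset_conj hback)

theorem normal_subgroupOf_image (hφ : IsGroupMorphism φ) {T U : Set S.Elem}
    (hT : S.IsClosedSubset T) (hU : S.IsClosedSubset U) (hTU : S.IsStronglyNormalIn T U) :
    ((hφ.image hT).subgroupOf (hφ.image hU)).Normal := by
  refine (Subgroup.normal_subgroupOf_iff (Set.image_mono hTU.1)).2 ?_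
  rintro _ _ ⟨t, ht, rfl⟩ ⟨u, hu, rfl⟩
  obtain ⟨r, hr⟩ : (S.conj (S.star u) {t}).Nonempty := mul_nonempty
    (mul_nonempty (Set.singleton_nonempty _) (Set.singleton_nonempty t)) (Set.singleton_nonempty _)
  refine ⟨r, hTU.2 _ (hU.star_mem hu) (conj_subset_conj (Set.singleton_subset_iff.2 ht) hr), ?_⟩
  obtain ⟨_, rfl, hrt⟩ := hφ.exists_map_eq_conj hr
  rw [hrt, hφ.map_star, inv_inv, MulAut.conj_apply]

end Conjugates

section Valency

theorem setValency_eq (hφ : IsGroupMorphism φ) {T : Set S.Elem} (hT : S.IsClosedSubset T) :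
    S.setValency T = Nat.card (hφ.image hT) * S.setValency (T ∩ φ ⁻¹' {1}) := by
  obtain ⟨x⟩ := S.nonempty_points
  have himage : (fun y => φ (S.rel x y)) '' {y | S.rel x y ∈ T} = hφ.image hT := by
    ext g
    refine ⟨fun ⟨y, hy, hg⟩ => ⟨_, hy, hg⟩, fun ⟨t, ht, hg⟩ => ?_⟩
    obtain ⟨y, rfl⟩ := exists_rel_eq_right x t
    exact ⟨y, ht, hg⟩
  have hfiber : ∀ y ∈ {y | S.rel x y ∈ T},
      {z | z ∈ {z | S.rel x z ∈ T} ∧ φ (S.rel x z) = φ (S.rel x y)}.ncard =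
        S.setValency (T ∩ φ ⁻¹' {1}) := fun y hy => by
    rw [setValency_eq_ncard _ y]
    congr 1
    ext z
    exact and_congr (hT.rel_mem_iff_left hy) (by rw [hφ x y z]; exact mul_eq_left)
  rw [setValency_eq_ncard T x, ncard_eq_ncard_image_mul _ hfiber, himage]
  rfl

theorem setValency_preimage (hφ : IsGroupMorphism φ) (hsurj : Function.Surjective φ)
    (H : Subgroup G) : S.setValency (φ ⁻¹' H) = Nat.card H * S.setValency (φ ⁻¹' {1}) := by
  have hker : φ ⁻¹' H ∩ φ ⁻¹' {1} = φ ⁻¹' {1} :=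
    Set.inter_eq_right.2 (Set.preimage_mono (Set.singleton_subset_iff.2 H.one_mem))
  rw [hφ.setValency_eq (hφ.isClosedSubset_preimage H), hφ.image_preimage hsurj, hker]

theorem index_preimage (hφ : IsGroupMorphism φ) (hsurj : Function.Surjective φ)
    (H : Subgroup G) : S.index (φ ⁻¹' H) Set.univ = H.index := by
  have huniv := hφ.setValency_preimage hsurj ⊤
  rw [Subgroup.coe_top, Set.preimage_univ, Subgroup.card_top, ← H.card_mul_index,
    mul_right_comm, ← hφ.setValency_preimage hsurj] at huniv
  rw [index, huniv]
  exact Nat.mul_div_cancel_left _ (setValency_pos (hφ.isClosedSubset_preimage H).1)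

theorem relIndex_image_dvd (hφ : IsGroupMorphism φ) {T U : Set S.Elem}
    (hT : S.IsClosedSubset T) (hU : S.IsClosedSubset U) (hTU : T ⊆ U) :
    (hφ.image hT).relIndex (hφ.image hU) ∣ S.index T U := by
  have hcard : Nat.card (hφ.image hU) =
      Nat.card (hφ.image hT) * (hφ.image hT).relIndex (hφ.image hU) := by
    rw [← Subgroup.relIndex_bot_left, ← Subgroup.relIndex_bot_left,
      Subgroup.relIndex_mul_relIndex _ _ _ bot_le (Set.image_mono hTU)]
  obtain ⟨k, hk⟩ := (hT.inter hφ.isClosedSubset_preimage_one).setValency_dvd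
    (hU.inter hφ.isClosedSubset_preimage_one) (Set.inter_subset_inter_left _ hTU)
  refine ⟨k, Nat.eq_of_mul_eq_mul_left (setValency_pos hT.1) ?_⟩
  rw [← hT.setValency_eq_mul_index hU hTU, hφ.setValency_eq hU, hφ.setValency_eq hT, hcard, hk]
  ring

end Valency

theorem isSolvable (hφ : IsGroupMorphism φ) (hsurj : Function.Surjective φ)
    (hS : S.IsSolvable) : Group.IsSolvable G := by
  obtain ⟨n, T, hT, hzero, hn, hstep⟩ := hS
  have hsolv (i : ℕ) (hi : i ≤ n) : Group.IsSolvable (hφ.image (hT i hi)) := by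
    induction i with
    | zero =>
      have hbot : hφ.image (hT 0 hi) = ⊥ := SetLike.coe_injective <| by
        change φ '' T 0 = {1}
        rw [hzero, Set.image_singleton, hφ.map_one]
      rw [hbot]
      infer_instance
    | succ i ih =>
      obtain ⟨hnormal, hprime⟩ := hstep i hi
      exact isSolvable_of_relIndex_dvd_prime (Set.image_mono hnormal.1)
        (hφ.normal_subgroupOf_image (hT i (by omega)) (hT (i + 1) hi) hnormal) (ih (by omega))
        hprime (hφ.relIndex_image_dvd _ _ hnormal.1)
  have htop : hφ.image (hT n le_rfl) = ⊤ := SetLike.coe_injective <| by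
    change φ '' T n = Set.univ
    rw [hn, Set.image_univ, hsurj.range_eq]
  have : Group.IsSolvable (⊤ : Subgroup G) := htop ▸ hsolv n le_rfl
  exact Group.isSolvable_of_surjective (f := (Subgroup.topEquiv (G := G)).toMonoidHom)
    Subgroup.topEquiv.surjective

end IsGroupMorphism

section HallSubsets

variable {π : Set ℕ} {T U : Set S.Elem}

theorem IsHallPiSubset.eq_of_subset (hT : S.IsHallPiSubset π T) (hU : S.IsClosedPiSubset π U)
    (h : T ⊆ U) : T = U := by
  have hTU := hT.1.1.setValency_eq_mul_index hU.1 h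
  have hindex : S.index T Set.univ = S.index T U * S.index U Set.univ := by
    refine Nat.eq_of_mul_eq_mul_left (setValency_pos hT.1.1.1) ?_
    rw [← mul_assoc, ← hTU, ← hU.1.setValency_eq_mul_index (.univ S) (Set.subset_univ U),
      ← hT.1.1.setValency_eq_mul_index (.univ S) (Set.subset_univ T)]
  have hone : S.index T U = 1 := Nat.eq_one_of_dvd_coprimes (hU.2.2.coprime hT.2)
    (Dvd.intro_left _ hTU.symm) (Dvd.intro _ hindex.symm)
  exact eq_of_subset_of_setValency_le h (by rw [hTU, hone, mul_one])

namespace IsGroupMorphism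

variable {G : Type*} [Group G] {φ : S.Elem → G} {H : Subgroup G}

theorem isPiNumber_card_image (hφ : IsGroupMorphism φ) (hT : S.IsClosedPiSubset π T) :
    IsPiNumber π (Nat.card (hφ.image hT.1)) :=
  hT.2.2.of_dvd (Dvd.intro _ (hφ.setValency_eq hT.1).symm)

theorem isClosedPiSubset_preimage (hφ : IsGroupMorphism φ) (hsurj : Function.Surjective φ)
    (hval : S.IsPiValenced π) (hker : IsPiNumber π (S.setValency (φ ⁻¹' {1})))
    (hH : IsPiNumber π (Nat.card H)) : S.IsClosedPiSubset π (φ ⁻¹' H) :=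
  ⟨hφ.isClosedSubset_preimage H, fun t _ => hval t (Set.mem_univ t),
    hφ.setValency_preimage hsurj H ▸ hH.mul hker⟩

theorem isHallPiSubset_preimage (hφ : IsGroupMorphism φ) (hsurj : Function.Surjective φ)
    (hval : S.IsPiValenced π) (hker : IsPiNumber π (S.setValency (φ ⁻¹' {1})))
    (hH : IsHallSubgroup π H) : S.IsHallPiSubset π (φ ⁻¹' H) :=
  ⟨hφ.isClosedPiSubset_preimage hsurj hval hker hH.1, (hφ.index_preimage hsurj H).symm ▸ hH.2⟩

theorem exists_isHallSubgroup_eq_preimage (hφ : IsGroupMorphism φ)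
    (hsurj : Function.Surjective φ) (hval : S.IsPiValenced π)
    (hker : IsPiNumber π (S.setValency (φ ⁻¹' {1}))) (hT : S.IsHallPiSubset π T) :
    ∃ H : Subgroup G, IsHallSubgroup π H ∧ T = φ ⁻¹' H := by
  have hcard := hφ.isPiNumber_card_image hT.1
  have hpre : T = φ ⁻¹' (hφ.image hT.1.1) := hT.eq_of_subset
    (hφ.isClosedPiSubset_preimage hsurj hval hker hcard) (Set.subset_preimage_image φ T)
  refine ⟨hφ.image hT.1.1, ⟨hcard, ?_⟩, hpre⟩
  rw [← hφ.index_preimage hsurj, ← hpre]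
  exact hT.2

end IsGroupMorphism

end HallSubsets

end AssociationScheme

open AssociationScheme in
theorem mainTheorem1 {X : Type*} [Finite X] (S : AssociationScheme X)
    (π : Set ℕ) (hπ : ∀ p ∈ π, p.Prime) (hsolv : S.IsSolvable) (hval : S.IsPiValenced π) :
    (∃ T : Set S.Elem, S.IsHallPiSubset π T) ∧
    (∀ T U : Set S.Elem, S.IsHallPiSubset π T → S.IsHallPiSubset π U → S.AreConjugate T U) ∧
    (∀ T : Set S.Elem, S.IsClosedPiSubset π T →
      ∃ U : Set S.Elem, S.IsHallPiSubset π U ∧ T ⊆ U) := by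
  obtain ⟨P, hP, hn, hPπ⟩ := exists_isStronglyNormalIn_isPiNumber_of_isSolvable hsolv hval
  let _ := hn.groupLeftCosets hP
  have hφ := hn.isGroupMorphism_leftCoset hP
  have hsurj := leftCoset_surjective P
  have hker : IsPiNumber π (S.setValency (leftCoset P ⁻¹' {1})) :=
    (hn.leftCoset_preimage_one hP).symm ▸ hPπ
  have := hφ.isSolvable hsurj hsolv
  obtain ⟨H, hH⟩ := exists_isHallSubgroup π (LeftCosets P)
  refine ⟨⟨_, hφ.isHallPiSubset_preimage hsurj hval hker hH⟩, fun T U hT hU => ?_, fun T hT => ?_⟩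
  · obtain ⟨K, hK, rfl⟩ := hφ.exists_isHallSubgroup_eq_preimage hsurj hval hker hT
    obtain ⟨L, hL, rfl⟩ := hφ.exists_isHallSubgroup_eq_preimage hsurj hval hker hU
    obtain ⟨g, hg⟩ := exists_le_conj_smul_of_isHallSubgroup hK hL.1
    obtain ⟨s, hs⟩ := hsurj g⁻¹
    refine ⟨s, ?_⟩
    rw [hφ.conj_preimage, hs, inv_inv, hL.eq_of_le hg (hK.conj_smul g).1]
  · obtain ⟨g, hg⟩ := exists_le_conj_smul_of_isHallSubgroup hH (hφ.isPiNumber_card_image hT)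
    exact ⟨_, hφ.isHallPiSubset_preimage hsurj hval hker (hH.conj_smul g),
      (Set.subset_preimage_image _ T).trans (Set.preimage_mono hg)⟩
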